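/- Let $\mathcal H_6=\mathbb C^6$ be a one-particle space with six modes, with fermionic creation and annihilation operators $\hat a_i^\dagger,\hat a_i$ ($1\le i\le 6$). A mixed state of three fermions is a positive semidefinite operator $\rho$ of trace $1$ on $\Lambda^3\mathcal H_6$. Its natural occupation numbers $\lambda_1\ge\dots\ge\lambda_6$ are the eigenvalues, with multiplicity and in decreasing order, of its one-particle reduced density matrix $\gamma_{ij}=\mathrm{Tr}(\rho\,\hat a_j^\dagger\hat a_i)$. (1) If the largest eigenvalue of $\rho$ is $1-\epsilon$, then $1\ge\lambda_1\ge\dots\ge\lambda_6\ge 0$, $\sum_{i=1}^6\lambda_i=3$, and $$\lambda_1+\lambda_2-\lambda_3\le 1+\epsilon,\qquad \lambda_1+\lambda_2+\lambda_4\le 2+\epsilon.$$ (2) For every $0\le\epsilon\le\tfrac12$ the state $\rho=(1-\epsilon)|111000\rangle\langle111000|+\epsilon|110100\rangle\langle110100|$ has largest eigenvalue $1-\epsilon$ and natural occupation numbers $(1,1,1-\epsilon,\epsilon,0,0)$, and so saturates both inequalities. (3) The pure-state relations $\lambda_1+\lambda_6=\lambda_2+\lambda_5=\lambda_3+\lambda_4=1$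 no longer hold: for every $0<\epsilon\le\tfrac12$ there is a mixed state with largest eigenvalue $1-\epsilon$ for which $\lambda_1+\lambda_6$, $\lambda_2+\lambda_5$ and $\lambda_3+\lambda_4$ all differ from $1$. Accordingly the two inequalities in (1) are independent: for every $0\le\epsilon<\tfrac12$ there are mixed states (with no condition on the largest eigenvalue) whose natural occupation numbers satisfy the first and violate the second, and others that satisfy the second and violate the first. -/

import Mathlib

/-! Fermions in `d` modes, in the occupation number representation. A finite set `S = {s₁ < ⋯ < sₙ}`
of modes labels the vector `|S⟩ = e_{s₁} ∧ ⋯ ∧ e_{sₙ} = a†_{s₁} ⋯ a†_{sₙ} |0⟩`; these vectors are an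
orthonormal basis of the Fock space `⨁ₙ Λⁿ ℂᵈ`, those with `S.card = N` one of `Λᴺ ℂᵈ`. -/

open scoped Matrix ComplexOrder

namespace Fermion

/-- The creation operator `a†ᵢ` on the Fock space of `d` modes:
`a†ᵢ |S⟩ = (-1) ^ #{s ∈ S | s < i} |S ∪ {i}⟩` if `i ∉ S`, and `a†ᵢ |S⟩ = 0` if `i ∈ S`. -/
def creation {d : ℕ} (i : Fin d) : Matrix (Finset (Fin d)) (Finset (Fin d)) ℂ :=
  Matrix.of fun T S =>
    if i ∉ S ∧ T = insert i S then (-1) ^ (S.filter (fun s => s < i)).card else 0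

/-- The annihilation operator `aᵢ`, the adjoint of `a†ᵢ`. -/
def annihilation {d : ℕ} (i : Fin d) : Matrix (Finset (Fin d)) (Finset (Fin d)) ℂ :=
  (creation i)ᴴ

/-- Labels of the occupation number basis of `Λᴺ ℂᵈ`: the `N`-element sets of modes. -/
abbrev Config (N d : ℕ) : Type := {S : Finset (Fin d) // S.card = N}

/-- The restriction of `a†ⱼ aᵢ`, which preserves the particle number, to `Λᴺ ℂᵈ`. -/
def hopping (N : ℕ) {d : ℕ} (j i : Fin d) : Matrix (Config N d) (Config N d) ℂ :=
  (creation j * annihilation i).submatrix Subtype.val Subtype.val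

/-- A (mixed) state of `N` fermions in `d` modes: a density matrix on `Λᴺ ℂᵈ`. -/
structure MixedState (N d : ℕ) where
  /-- The matrix of the state in the occupation number basis. -/
  matrix : Matrix (Config N d) (Config N d) ℂ
  posSemidef : matrix.PosSemidef
  trace_eq_one : matrix.trace = 1

/-- The one-particle reduced density matrix `γᵢⱼ = Tr(ρ a†ⱼ aᵢ)`. -/
def oneRDM {N d : ℕ} (ρ : MixedState N d) : Matrix (Fin d) (Fin d) ℂ :=
  Matrix.of fun i j => (ρ.matrix * hopping N j i).trace

theorem hopping_conjTranspose (N : ℕ) {d : ℕ} (j i : Fin d) :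
    (hopping N j i)ᴴ = hopping N i j := by
  simp [hopping, annihilation, Matrix.conjTranspose_submatrix, Matrix.conjTranspose_mul]

theorem oneRDM_isHermitian {N d : ℕ} (ρ : MixedState N d) : (oneRDM ρ).IsHermitian := by
  refine Matrix.IsHermitian.ext fun i j => ?_
  simp only [oneRDM, Matrix.of_apply]
  rw [← Matrix.trace_conjTranspose, Matrix.conjTranspose_mul, hopping_conjTranspose,
    ρ.posSemidef.isHermitian.eq, Matrix.trace_mul_comm]

/-- The natural occupation numbers `λ₁ ≥ ⋯ ≥ λ_d` of a state: the eigenvalues of its one-particle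
reduced density matrix, with multiplicity, in decreasing order (indexed from `0`). -/
noncomputable def occ {N d : ℕ} (ρ : MixedState N d) : Fin d → ℝ :=
  fun i => (oneRDM_isHermitian ρ).eigenvalues₀ (Fin.cast (Fintype.card_fin d).symm i)

/-- The rank-one projector `|S⟩⟨S|` onto a vector of the occupation number basis. -/
def ketbra {N d : ℕ} (S : Config N d) : Matrix (Config N d) (Config N d) ℂ :=
  Matrix.vecMulVec (Pi.single S 1) (star (Pi.single S 1))

end Fermion

/-! The state `ρ` dominates `c |ψ⟩⟨ψ|`, where `ψ` is a unit eigenvector for the eigenvalue `c = 1 -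
ε`, so expectations of positive operators in `ρ` are at least `c` times those in `ψ`. Work with the
annihilators `b k` of the natural orbitals, and let `χ = b q b p ψ`; for three particles this is a
one-particle vector. Three estimates combine in `CAR.pair_le`. Positivity of the hole operators `b j
(b j)ᴴ` gives `1 - λ_j ≥ c (1 - ‖b j ψ‖²)`. The anticommutation relations give `‖b p ψ‖² + ‖b q ψ‖²
≤ 1 + ‖χ‖²`. Finally, let `B` annihilate a particle in the orbital `χ`: its expectation `Tr(ρ Bᴴ B)`
is at least `c ‖χ‖⁴`, and at most `μ ‖χ‖²` because `χ` has no component along `p` or `q`; hence `c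
‖χ‖² ≤ μ`. Together, `λ_p + λ_q - μ ≤ 2 - c`. With `p, q` the two most occupied orbitals this is the
first inequality. Since creation operators satisfy the same relations, the argument applies to
holes, with the two least occupied orbitals, and yields `λ₄ - λ₅ - λ₆ ≤ ε`. Averaging the two bounds
and using `∑ λ = 3` gives the second inequality. The existence claims use mixtures of
configurations, whose one-particle matrix is diagonal. -/

namespace Fermion

/-! ### Squared norms and expectations of positive operators -/

section SqNorm

variable {F : Type*} [Fintype F]

/-- The squared norm of a vector. -/
def sqNorm (x : F → ℂ) : ℝ := ∑ S, Complex.normSq (x S)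

theorem sqNorm_nonneg (x : F → ℂ) : 0 ≤ sqNorm x :=
  Finset.sum_nonneg fun _ _ => Complex.normSq_nonneg _

theorem normSq_le_sqNorm (x : F → ℂ) (S : F) : Complex.normSq (x S) ≤ sqNorm x :=
  Finset.single_le_sum (f := fun S => Complex.normSq (x S))
    (fun _ _ => Complex.normSq_nonneg _) (Finset.mem_univ S)

theorem sqNorm_neg (x : F → ℂ) : sqNorm (-x) = sqNorm x := by
  simp [sqNorm]

theorem ofReal_sqNorm (x : F → ℂ) : (sqNorm x : ℂ) = star x ⬝ᵥ x := by
  simp [sqNorm, dotProduct, Complex.normSq_eq_conj_mul_self]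

theorem ofReal_sqNorm_mulVec {G : Type*} [Fintype G] (A : Matrix G F ℂ) (x : F → ℂ) :
    (sqNorm (A *ᵥ x) : ℂ) = star x ⬝ᵥ ((Aᴴ * A) *ᵥ x) := by
  rw [ofReal_sqNorm, Matrix.star_mulVec, ← Matrix.dotProduct_mulVec, Matrix.mulVec_mulVec]

theorem sqNorm_mulVec_of_isometry [DecidableEq F] {G : Type*} [Fintype G] {A : Matrix G F ℂ}
    (hA : Aᴴ * A = 1) (x : F → ℂ) : sqNorm (A *ᵥ x) = sqNorm x := by
  apply Complex.ofReal_injective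
  rw [ofReal_sqNorm_mulVec, hA, Matrix.one_mulVec, ofReal_sqNorm]

theorem re_trace_mul_nonneg {P : Matrix F F ℂ} (hP : P.PosSemidef) (Y : Matrix F F ℂ) :
    0 ≤ (P * (Yᴴ * Y)).trace.re := by
  have h := (hP.mul_mul_conjTranspose_same Y).trace_nonneg
  rw [Matrix.trace_mul_comm, ← Matrix.mul_assoc, Matrix.trace_mul_comm] at h
  exact (Complex.nonneg_iff.mp h).1

/-- The trace against the positive operator `Yᴴ * Y` is monotone, and the projector onto `ψ`
contributes exactly `‖Yψ‖²`. This is the only way in which the large eigenvalue of the state enters.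
-/
theorem mul_sqNorm_le_re_trace {P : Matrix F F ℂ} {ψ : F → ℂ} {c : ℝ}
    (hP : (P - (c : ℂ) • Matrix.vecMulVec ψ (star ψ)).PosSemidef) (Y : Matrix F F ℂ) :
    c * sqNorm (Y *ᵥ ψ) ≤ (P * (Yᴴ * Y)).trace.re := by
  have h := re_trace_mul_nonneg hP Y
  have h2 : (Matrix.vecMulVec ψ (star ψ) * (Yᴴ * Y)).trace = (sqNorm (Y *ᵥ ψ) : ℂ) := by
    rw [ofReal_sqNorm_mulVec, Matrix.trace_mul_comm, Matrix.mul_vecMulVec,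
      Matrix.trace_vecMulVec, dotProduct_comm]
  rw [Matrix.sub_mul, Matrix.trace_sub, Matrix.smul_mul, Matrix.trace_smul, h2, smul_eq_mul,
    ← Complex.ofReal_mul, Complex.sub_re, Complex.ofReal_re] at h
  linarith

end SqNorm

/-! ### Anticommutation relations and the two-orbital inequality -/

section CAR

variable {n F : Type*}

/-- The family of annihilation operators of the modes given by the columns of `U`. -/
def rotate [Fintype n] (U : Matrix n n ℂ) (b : n → Matrix F F ℂ) (k : n) : Matrix F F ℂ :=
  ∑ i, star (U i k) • b i

theorem rotate_conjTranspose [Fintype n] (U : Matrix n n ℂ) (b : n → Matrix F F ℂ) (k : n) :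
    (rotate U b k)ᴴ = ∑ i, U i k • (b i)ᴴ := by
  simp [rotate, Matrix.conjTranspose_sum]

theorem conjTranspose_rotate [Fintype n] (U : Matrix n n ℂ) (b : n → Matrix F F ℂ) (k : n) :
    (rotate U b k)ᴴ = rotate (U.map star) (fun i => (b i)ᴴ) k := by
  simp [rotate, Matrix.conjTranspose_sum]

/-- The overlaps transform by the unitary `Uᴴ`. Thus the condition `hω` of `CAR.pair_le`, once
checked in the original modes, holds for the natural orbitals. -/
theorem sqNorm_rotate_apply [Fintype n] [DecidableEq n] [Fintype F] {U : Matrix n n ℂ}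
    (hU : U * Uᴴ = 1) (b : n → Matrix F F ℂ) (x : F → ℂ) (ω : F) :
    sqNorm (fun k => (rotate U b k *ᵥ x) ω) = sqNorm fun k => (b k *ᵥ x) ω := by
  rw [← sqNorm_mulVec_of_isometry (A := Uᴴ) (by rwa [Matrix.conjTranspose_conjTranspose])
    fun k => (b k *ᵥ x) ω]
  congr 1
  ext k
  rw [Fermion.rotate, Matrix.sum_mulVec, Finset.sum_apply]
  simp [Matrix.mulVec, dotProduct, Finset.mul_sum, mul_assoc]

variable [DecidableEq n] [Fintype F] [DecidableEq F]

/-- The canonical anticommutation relations for a family of annihilation operators. -/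
structure CAR (b : n → Matrix F F ℂ) : Prop where
  anticomm : ∀ i j, b i * b j + b j * b i = 0
  anticomm_conj : ∀ i j, b i * (b j)ᴴ + (b j)ᴴ * b i = if i = j then 1 else 0

namespace CAR

variable {b : n → Matrix F F ℂ}

/-- Creation operators are the annihilation operators of holes. -/
theorem dual (hb : CAR b) : CAR fun i => (b i)ᴴ where
  anticomm i j := by
    rw [← Matrix.conjTranspose_mul, ← Matrix.conjTranspose_mul, ← Matrix.conjTranspose_add,
      hb.anticomm, Matrix.conjTranspose_zero]
  anticomm_conj i j := by
    rw [Matrix.conjTranspose_conjTranspose, add_comm, hb.anticomm_conj]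
    simp [eq_comm]

theorem sqNorm_add (hb : CAR b) (i : n) (x : F → ℂ) :
    sqNorm (b i *ᵥ x) + sqNorm ((b i)ᴴ *ᵥ x) = sqNorm x := by
  apply Complex.ofReal_injective
  rw [Complex.ofReal_add, ofReal_sqNorm_mulVec, ofReal_sqNorm_mulVec, ← dotProduct_add,
    ← Matrix.add_mulVec, Matrix.conjTranspose_conjTranspose, add_comm, hb.anticomm_conj, if_pos rfl,
    Matrix.one_mulVec, ofReal_sqNorm]

theorem sqNorm_mulVec_le (hb : CAR b) (i : n) (x : F → ℂ) : sqNorm (b i *ᵥ x) ≤ sqNorm x := by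
  linarith [hb.sqNorm_add i x, sqNorm_nonneg ((b i)ᴴ *ᵥ x)]

theorem mulVec_mulVec_comm (hb : CAR b) (i j : n) (x : F → ℂ) :
    b i *ᵥ (b j *ᵥ x) = -(b j *ᵥ (b i *ᵥ x)) := by
  rw [Matrix.mulVec_mulVec, Matrix.mulVec_mulVec, eq_neg_of_add_eq_zero_left (hb.anticomm i j),
    Matrix.neg_mulVec]

theorem mulVec_mulVec_self (hb : CAR b) (i : n) (x : F → ℂ) : b i *ᵥ (b i *ᵥ x) = 0 :=
  self_eq_neg.mp (hb.mulVec_mulVec_comm i i x)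

/-- The expectation in `ψ` of `(1 - n_p)(1 - n_q) ≥ 0`, a product of commuting projectors, where
`n_p` is the number operator of mode `p`. -/
theorem sqNorm_pair (hb : CAR b) {p q : n} (hpq : p ≠ q) (ψ : F → ℂ) :
    sqNorm (b p *ᵥ ψ) + sqNorm (b q *ᵥ ψ) ≤ sqNorm ψ + sqNorm (b q *ᵥ (b p *ᵥ ψ)) := by
  have h1 := hb.sqNorm_add p ψ
  have h2 := hb.sqNorm_mulVec_le q ((b p)ᴴ *ᵥ ψ)
  have h3 : b q *ᵥ ((b p)ᴴ *ᵥ ψ) = -((b p)ᴴ *ᵥ (b q *ᵥ ψ)) := by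
    have := hb.anticomm_conj q p
    rw [if_neg hpq.symm] at this
    rw [Matrix.mulVec_mulVec, Matrix.mulVec_mulVec, eq_neg_of_add_eq_zero_left this,
      Matrix.neg_mulVec]
  have h4 := hb.sqNorm_add p (b q *ᵥ ψ)
  rw [hb.mulVec_mulVec_comm p q, sqNorm_neg] at h4
  rw [h3, sqNorm_neg] at h2
  linarith

variable [Fintype n]

theorem rotate (hb : CAR b) {U : Matrix n n ℂ} (hU : Uᴴ * U = 1) : CAR (rotate U b) where
  anticomm i j := by
    have h : ∀ p q, (star (U p i) • b p) * (star (U q j) • b q)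
        + (star (U q j) • b q) * (star (U p i) • b p) = 0 := fun p q => by
      rw [Matrix.smul_mul, Matrix.smul_mul, Matrix.mul_smul, Matrix.mul_smul, smul_smul, smul_smul,
        mul_comm (star (U q j)), ← smul_add, hb.anticomm, smul_zero]
    rw [Fermion.rotate, Fermion.rotate, Finset.sum_mul_sum, Finset.sum_mul_sum,
      Finset.sum_comm (γ := n) (f := fun q p => (star (U q j) • b q) * (star (U p i) • b p)),
      ← Finset.sum_add_distrib]
    refine Finset.sum_eq_zero fun p _ => ?_
    rw [← Finset.sum_add_distrib]
    exact Finset.sum_eq_zero fun q _ => h p q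
  anticomm_conj i j := by
    have h : ∀ p q, (star (U p i) • b p) * (U q j • (b q)ᴴ)
        + (U q j • (b q)ᴴ) * (star (U p i) • b p)
        = if p = q then (star (U p i) * U q j) • 1 else 0 := fun p q => by
      rw [Matrix.smul_mul, Matrix.smul_mul, Matrix.mul_smul, Matrix.mul_smul, smul_smul, smul_smul,
        mul_comm (U q j), ← smul_add, hb.anticomm_conj, smul_ite, smul_zero]
    rw [rotate_conjTranspose, Fermion.rotate, Finset.sum_mul_sum, Finset.sum_mul_sum,
      Finset.sum_comm (γ := n) (f := fun q p => (U q j • (b q)ᴴ) * (star (U p i) • b p)),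
      ← Finset.sum_add_distrib]
    simp_rw [← Finset.sum_add_distrib, h, Finset.sum_ite_eq, Finset.mem_univ, if_true,
      ← Finset.sum_smul]
    have := congrFun (congrFun hU i) j
    rw [Matrix.mul_apply, Matrix.one_apply] at this
    simp only [Matrix.conjTranspose_apply] at this
    rw [this, ite_smul, one_smul, zero_smul]

/-- If `P` dominates `c |ψ⟩⟨ψ|` and has occupation numbers `lam`, and annihilating the modes `p` and
`q` in `ψ` leaves a one-particle state over the vacuum `ω`, then `lam p + lam q` exceeds the other
occupation numbers by at most `2 - c`. -/
theorem pair_le (hb : CAR b) {P : Matrix F F ℂ} (htr : P.trace = 1)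
    {ψ : F → ℂ} (hψ : sqNorm ψ = 1) {c : ℝ} (hc : 0 ≤ c)
    (hP : (P - (c : ℂ) • Matrix.vecMulVec ψ (star ψ)).PosSemidef) {lam : n → ℝ}
    (hlam : ∀ j k, (P * ((b j)ᴴ * b k)).trace = if j = k then (lam j : ℂ) else 0)
    {p q : n} (hpq : p ≠ q) (ω : F)
    (hω : sqNorm (fun k => (b k *ᵥ (b q *ᵥ (b p *ᵥ ψ))) ω) = sqNorm (b q *ᵥ (b p *ᵥ ψ)))
    {μ : ℝ} (hμ0 : 0 ≤ μ) (hμ : ∀ k, k ≠ p → k ≠ q → lam k ≤ μ) :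
    lam p + lam q - μ ≤ 2 - c := by
  -- Domination tested on `b j (b j)ᴴ`, the probability that mode `j` is empty.
  have hhole : ∀ j, c * (1 - sqNorm (b j *ᵥ ψ)) ≤ 1 - lam j := fun j => by
    have h := mul_sqNorm_le_re_trace hP (b j)ᴴ
    have h2 : b j * (b j)ᴴ = 1 - (b j)ᴴ * b j :=
      eq_sub_of_add_eq ((hb.anticomm_conj j j).trans (if_pos rfl))
    rw [Matrix.conjTranspose_conjTranspose, h2, Matrix.mul_sub, Matrix.trace_sub, hlam, if_pos rfl,
      Matrix.mul_one, htr, Complex.sub_re, Complex.one_re, Complex.ofReal_re] at h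
    rwa [← hψ, ← hb.sqNorm_add j ψ, add_sub_cancel_left, hb.sqNorm_add j ψ, hψ]
  set χ := b q *ᵥ (b p *ᵥ ψ) with hχ
  set φ : n → ℂ := fun k => (b k *ᵥ χ) ω with hφ
  -- `φ` holds the one-particle amplitudes of `χ` over `ω`, and `B` is the unnormalised annihilator
  -- of that orbital, so that `⟨ω|Bχ⟩ = ‖φ‖² = ‖χ‖²`.
  set B : Matrix F F ℂ := ∑ k, star (φ k) • b k with hB
  have hφp : φ p = 0 := by
    simp only [hφ, hχ]
    rw [hb.mulVec_mulVec_comm p q, hb.mulVec_mulVec_self, Matrix.mulVec_zero, neg_zero]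
    rfl
  have hφq : φ q = 0 := by
    simp only [hφ, hχ]
    rw [hb.mulVec_mulVec_self]
    rfl
  have hBanti : ∀ j x, b j *ᵥ (B *ᵥ x) = -(B *ᵥ (b j *ᵥ x)) := fun j x => by
    simp only [hB, Matrix.sum_mulVec, Matrix.mulVec_sum, Matrix.smul_mulVec, Matrix.mulVec_smul]
    rw [← Finset.sum_neg_distrib]
    refine Finset.sum_congr rfl fun k _ => ?_
    rw [hb.mulVec_mulVec_comm, smul_neg]
  -- `B` anticommutes with `b p` and `b q`, so `Bχ` is also `b q b p (Bψ)`; annihilators are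
  -- contractions, and the `ω`-component of `Bχ` is already `‖χ‖²`.
  have hlow : sqNorm χ ^ 2 ≤ sqNorm (B *ᵥ ψ) := by
    have h1 : (B *ᵥ χ) ω = (sqNorm φ : ℂ) := by
      rw [ofReal_sqNorm, hB, Matrix.sum_mulVec, Finset.sum_apply]
      simp [dotProduct, hφ, Matrix.smul_mulVec]
    have h2 := normSq_le_sqNorm (B *ᵥ χ) ω
    have h3 : B *ᵥ χ = b q *ᵥ (b p *ᵥ (B *ᵥ ψ)) := by
      rw [hBanti p, Matrix.mulVec_neg, hBanti q, neg_neg]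
    rw [h1, Complex.normSq_ofReal, hω, h3, ← sq] at h2
    exact h2.trans ((hb.sqNorm_mulVec_le q _).trans (hb.sqNorm_mulVec_le p _))
  -- In natural orbitals the cross terms vanish, leaving a weighted sum of occupation numbers in
  -- which `p` and `q` have weight zero.
  have hup : (P * (Bᴴ * B)).trace.re ≤ μ * sqNorm χ := by
    have h1 : (P * (Bᴴ * B)).trace = ((∑ k, Complex.normSq (φ k) * lam k : ℝ) : ℂ) := by
      rw [hB, Matrix.conjTranspose_sum, Finset.sum_mul_sum, Matrix.mul_sum, Matrix.trace_sum,
        Complex.ofReal_sum]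
      refine Finset.sum_congr rfl fun j _ => ?_
      rw [Matrix.mul_sum, Matrix.trace_sum, Finset.sum_eq_single j]
      · simp [hlam, Complex.normSq_eq_conj_mul_self]
        ring
      · intro k _ hk
        simp [hlam, hk.symm]
      · simp
    rw [h1, Complex.ofReal_re, ← hω, sqNorm, Finset.mul_sum]
    refine Finset.sum_le_sum fun k _ => ?_
    by_cases hkp : k = p
    · simp [hkp, hφp]
    by_cases hkq : k = q
    · simp [hkq, hφq]
    rw [mul_comm μ]
    exact mul_le_mul_of_nonneg_left (hμ k hkp hkq) (Complex.normSq_nonneg _)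
  have hcμ : c * sqNorm χ ≤ μ := by
    have h := (mul_le_mul_of_nonneg_left hlow hc).trans ((mul_sqNorm_le_re_trace hP B).trans hup)
    -- One factor `‖χ‖²` is cancelled from `c ‖χ‖⁴ ≤ μ ‖χ‖²`; when `χ = 0` the claim is `0 ≤ μ`.
    rcases (sqNorm_nonneg χ).eq_or_lt with h0 | h0
    · rw [← h0, mul_zero]
      exact hμ0
    · refine le_of_mul_le_mul_right ?_ h0
      rwa [mul_assoc, ← sq]
  have hpair := mul_le_mul_of_nonneg_left (hb.sqNorm_pair hpq ψ) hc
  have hp := hhole p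
  have hq := hhole q
  rw [hψ] at hpair
  linarith

end CAR

/-- A Hermitian matrix minus one term of its spectral decomposition. -/
theorem posSemidef_sub_eigenvector {A : Matrix F F ℂ} (hA : A.PosSemidef) (i : F) :
    (A - (hA.isHermitian.eigenvalues i : ℂ) • Matrix.vecMulVec
      ⇑(hA.isHermitian.eigenvectorBasis i)
      (star ⇑(hA.isHermitian.eigenvectorBasis i))).PosSemidef := by
  set U : Matrix F F ℂ := (hA.isHermitian.eigenvectorUnitary : Matrix F F ℂ) with hU
  set e := hA.isHermitian.eigenvalues with he
  have h1 : A = U * Matrix.diagonal (fun j => (e j : ℂ)) * Uᴴ := hA.isHermitian.spectral_theorem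
  have h2 : Matrix.vecMulVec ⇑(hA.isHermitian.eigenvectorBasis i)
      (star ⇑(hA.isHermitian.eigenvectorBasis i))
      = U * Matrix.diagonal (Pi.single i 1) * Uᴴ := by
    ext j k
    rw [Matrix.mul_apply, Finset.sum_eq_single i]
    · simp [Matrix.vecMulVec_apply, hU]
    · intro l _ hl
      simp [Matrix.mul_diagonal, hl]
    · simp
  -- Removing the term replaces the `i`-th eigenvalue by zero and keeps the others.
  have h3 : A - (e i : ℂ) • (U * Matrix.diagonal (Pi.single i 1) * Uᴴ)
      = U * Matrix.diagonal (fun j => if j = i then 0 else (e j : ℂ)) * Uᴴ := by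
    conv_lhs => rw [h1]
    rw [← Matrix.smul_mul, ← Matrix.mul_smul, ← Matrix.sub_mul, ← Matrix.mul_sub]
    congr 2
    ext j k
    by_cases hjk : j = k
    · subst hjk
      by_cases hj : j = i
      · subst hj; simp
      · simp [hj]
    · simp [hjk]
  rw [h2, h3]
  refine Matrix.PosSemidef.mul_mul_conjTranspose_same (Matrix.PosSemidef.diagonal fun j => ?_) _
  by_cases hj : j = i
  · simp [hj]
  · simpa [hj] using hA.eigenvalues_nonneg j

end CAR

/-! ### Fock space operators and particle number -/

section Fock

variable {d : ℕ}

/-- The sign `(-1) ^ #{s ∈ S | s < i}`. -/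
def jwSign (i : Fin d) (S : Finset (Fin d)) : ℂ := (-1) ^ (S.filter (fun s => s < i)).card

theorem jwSign_mul_self (i : Fin d) (S : Finset (Fin d)) : jwSign i S * jwSign i S = 1 := by
  simp [jwSign, ← mul_pow]

theorem jwSign_insert {i j : Fin d} {S : Finset (Fin d)} (hj : j ∉ S) :
    jwSign i (insert j S) = (if j < i then -1 else 1) * jwSign i S := by
  unfold jwSign
  rw [Finset.filter_insert]
  split_ifs with h
  · rw [Finset.card_insert_of_notMem (by simp [hj]), pow_succ, mul_comm]
  · rw [one_mul]

theorem jwSign_erase {i j : Fin d} {S : Finset (Fin d)} (hj : j ∈ S) :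
    jwSign i (S.erase j) = (if j < i then -1 else 1) * jwSign i S := by
  conv_rhs => rw [← Finset.insert_erase hj, jwSign_insert (Finset.notMem_erase j S), ← mul_assoc]
  split_ifs <;> simp

theorem annihilation_mul_apply {m : Type*} (i : Fin d) (M : Matrix (Finset (Fin d)) m ℂ)
    (S : Finset (Fin d)) (T : m) :
    (annihilation i * M) S T = if i ∈ S then 0 else jwSign i S * M (insert i S) T := by
  rw [Matrix.mul_apply, Finset.sum_eq_single (insert i S)]
  · by_cases h : i ∈ S <;> simp [annihilation, creation, h, jwSign]
  · intro R _ hR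
    simp [annihilation, creation, hR]
  · simp

theorem creation_mul_apply {m : Type*} (i : Fin d) (M : Matrix (Finset (Fin d)) m ℂ)
    (S : Finset (Fin d)) (T : m) :
    (creation i * M) S T = if i ∈ S then jwSign i S * M (S.erase i) T else 0 := by
  by_cases h : i ∈ S
  · rw [Matrix.mul_apply, Finset.sum_eq_single (S.erase i)]
    · have := jwSign_erase (i := i) h
      simp only [lt_irrefl, if_false, one_mul] at this
      simp [creation, h, ← this]
      left
      rfl
    · intro R _ hR
      have : ¬ (i ∉ R ∧ S = insert i R) := fun ⟨h1, h2⟩ =>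
        hR (by rw [h2, Finset.erase_insert h1])
      simp [creation, this]
    · simp
  · rw [Matrix.mul_apply, if_neg h]
    refine Finset.sum_eq_zero fun R _ => ?_
    have : ¬ (i ∉ R ∧ S = insert i R) := fun ⟨_, h2⟩ => h (by simp [h2])
    simp [creation, this]

theorem annihilation_mulVec_apply (i : Fin d) (x : Finset (Fin d) → ℂ) (S : Finset (Fin d)) :
    (annihilation i *ᵥ x) S = if i ∈ S then 0 else jwSign i S * x (insert i S) := by
  have := annihilation_mul_apply i (Matrix.of fun S (_ : Unit) => x S) S ()
  rwa [Matrix.mul_apply] at this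

theorem creation_mulVec_apply (i : Fin d) (x : Finset (Fin d) → ℂ) (S : Finset (Fin d)) :
    (creation i *ᵥ x) S = if i ∈ S then jwSign i S * x (S.erase i) else 0 := by
  have := creation_mul_apply i (Matrix.of fun S (_ : Unit) => x S) S ()
  rwa [Matrix.mul_apply] at this

theorem conjTranspose_annihilation (i : Fin d) : (annihilation i)ᴴ = creation i :=
  Matrix.conjTranspose_conjTranspose _

theorem car_annihilation : CAR (annihilation (d := d)) where
  anticomm i j := by
    ext S T
    -- A trailing identity matrix lets the entry formula for a left factor be applied twice.
    rw [← Matrix.mul_one (annihilation j), ← Matrix.mul_one (annihilation i), Matrix.mul_assoc,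
      Matrix.mul_assoc, Matrix.one_mul, Matrix.one_mul]
    simp only [Matrix.add_apply, annihilation_mul_apply, Matrix.zero_apply, Finset.mem_insert,
      Matrix.one_apply]
    rcases eq_or_ne i j with rfl | hij
    · simp
    by_cases hi : i ∈ S
    · simp [hi]
    by_cases hj : j ∈ S
    · simp [hj]
    simp only [hi, hj, hij, hij.symm, or_self, if_false, jwSign_insert hi, jwSign_insert hj,
      Finset.insert_comm i j]
    -- Inserting a mode changes the sign attached to the other only if it precedes it, so exactly
    -- one of the two orders acquires a minus sign.
    rcases lt_or_gt_of_ne hij with h | h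
    · simp only [h, h.not_gt, if_true, if_false]
      ring
    · simp only [h, h.not_gt, if_true, if_false]
      ring
  anticomm_conj i j := by
    ext S T
    rw [conjTranspose_annihilation, ← Matrix.mul_one (annihilation i),
      ← Matrix.mul_one (creation j), Matrix.mul_assoc,
      Matrix.mul_assoc, Matrix.one_mul, Matrix.one_mul]
    simp only [Matrix.add_apply, annihilation_mul_apply, creation_mul_apply, Finset.mem_insert,
      Finset.mem_erase, Matrix.one_apply]
    rcases eq_or_ne i j with rfl | hij
    · have := jwSign_mul_self i S
      by_cases hi : i ∈ S
      · simp [hi, jwSign_erase, this, Finset.insert_erase, Matrix.one_apply]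
      · simp [hi, jwSign_insert, this, Matrix.one_apply]
    · by_cases hi : i ∈ S
      · simp [hi, hij]
      by_cases hj : j ∈ S
      · simp only [hi, hj, hij, if_false, jwSign_insert hi, jwSign_erase hj,
          Finset.erase_insert_of_ne hij, if_true, or_true, and_false]
        rcases lt_or_gt_of_ne hij with h | h
        · simp only [h, h.not_gt, if_true, if_false, Matrix.zero_apply]
          ring
        · simp only [h, h.not_gt, if_true, if_false, Matrix.zero_apply]
          ring
      · simp [hj, hij, hij.symm]

/-- A vector of the Fock space with exactly `m` particles. -/
def HasParticles (m : ℕ) (x : Finset (Fin d) → ℂ) : Prop := ∀ S, S.card ≠ m → x S = 0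

theorem HasParticles.rotate {U : Matrix (Fin d) (Fin d) ℂ}
    {b : Fin d → Matrix (Finset (Fin d)) (Finset (Fin d)) ℂ} {m : ℕ} {x : Finset (Fin d) → ℂ}
    (h : ∀ i, HasParticles m (b i *ᵥ x)) (k : Fin d) : HasParticles m (rotate U b k *ᵥ x) := by
  intro S hS
  rw [Fermion.rotate, Matrix.sum_mulVec, Finset.sum_apply]
  refine Finset.sum_eq_zero fun i _ => ?_
  rw [Matrix.smul_mulVec, Pi.smul_apply, h i S hS, smul_zero]

theorem HasParticles.annihilation {m : ℕ} {x : Finset (Fin d) → ℂ} (hx : HasParticles (m + 1) x)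
    (i : Fin d) : HasParticles m (annihilation i *ᵥ x) := by
  intro S hS
  rw [annihilation_mulVec_apply]
  split_ifs with h
  · rfl
  · rw [hx _ (by rwa [Finset.card_insert_of_notMem h, Ne, add_left_inj]), mul_zero]

theorem HasParticles.creation {m : ℕ} {x : Finset (Fin d) → ℂ} (hx : HasParticles m x)
    (i : Fin d) : HasParticles (m + 1) (creation i *ᵥ x) := by
  intro S hS
  rw [creation_mulVec_apply]
  split_ifs with h
  · rw [hx _ fun h' => hS (by rw [← h', Finset.card_erase_add_one h]), mul_zero]
  · rfl

theorem normSq_jwSign (i : Fin d) (S : Finset (Fin d)) : Complex.normSq (jwSign i S) = 1 := by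
  simp [jwSign]

/-- A one-particle vector is recovered from its overlaps with the vectors `a†ᵢ |0⟩`. -/
theorem HasParticles.sqNorm_one {x : Finset (Fin d) → ℂ} (hx : HasParticles 1 x) :
    sqNorm (fun i => (Fermion.annihilation i *ᵥ x) ∅) = sqNorm x := by
  simp only [annihilation_mulVec_apply, sqNorm, Finset.notMem_empty, if_false,
    Complex.normSq_mul, normSq_jwSign, one_mul]
  refine Finset.sum_of_injOn (fun i => insert i ∅) (fun i _ j _ h => by simpa using h)
    (fun _ _ => Finset.mem_coe.mpr (Finset.mem_univ _)) (fun S _ hS => ?_) fun _ _ => rfl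
  rw [hx S, map_zero]
  intro h
  obtain ⟨i, rfl⟩ := Finset.card_eq_one.mp h
  exact hS ⟨i, by simp, by simp⟩

/-- A one-hole vector is recovered from its overlaps with the vectors obtained by emptying one mode
of the completely filled state. -/
theorem HasParticles.sqNorm_pred {m : ℕ} {x : Finset (Fin (m + 1)) → ℂ} (hx : HasParticles m x) :
    sqNorm (fun i => (Fermion.creation i *ᵥ x) Finset.univ) = sqNorm x := by
  simp only [creation_mulVec_apply, sqNorm, Finset.mem_univ, if_true,
    Complex.normSq_mul, normSq_jwSign, one_mul]
  refine Finset.sum_of_injOn (fun i => Finset.univ.erase i)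
    (fun i _ j _ h => by simpa [← Finset.compl_singleton] using h)
    (fun _ _ => Finset.mem_coe.mpr (Finset.mem_univ _)) (fun S _ hS => ?_) fun _ _ => rfl
  rw [hx S, map_zero]
  intro h
  have : Sᶜ.card = 1 := by rw [Finset.card_compl, h, Fintype.card_fin]; omega
  obtain ⟨i, hi⟩ := Finset.card_eq_one.mp this
  exact hS ⟨i, by simp, by simp only [← Finset.compl_singleton, ← hi, compl_compl]⟩

end Fock

/-! ### States as Fock space operators, and natural orbitals -/

section Embedding

variable (N d : ℕ)

/-- The inclusion of `Λᴺ ℂᵈ` into the Fock space. -/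
def inclusion : Matrix (Finset (Fin d)) (Config N d) ℂ :=
  (1 : Matrix (Finset (Fin d)) (Finset (Fin d)) ℂ).submatrix id Subtype.val

variable {N d}

theorem conjTranspose_inclusion_mul_mul (X : Matrix (Finset (Fin d)) (Finset (Fin d)) ℂ) :
    (inclusion N d)ᴴ * X * inclusion N d = X.submatrix Subtype.val Subtype.val := by
  ext S T
  simp [inclusion, Matrix.mul_apply, Matrix.one_apply]

theorem conjTranspose_inclusion_mul : (inclusion N d)ᴴ * inclusion N d = 1 := by
  rw [← Matrix.mul_one (inclusion N d)ᴴ, conjTranspose_inclusion_mul_mul,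
    Matrix.submatrix_one _ Subtype.val_injective]

theorem hasParticles_inclusion (v : Config N d → ℂ) : HasParticles N (inclusion N d *ᵥ v) := by
  intro S hS
  rw [Matrix.mulVec, dotProduct]
  refine Finset.sum_eq_zero fun c _ => ?_
  have : S ≠ c.1 := fun h => hS (h ▸ c.2)
  simp [inclusion, this]

/-- A state of `N` fermions as an operator on the Fock space. -/
noncomputable def MixedState.fock (ρ : MixedState N d) :
    Matrix (Finset (Fin d)) (Finset (Fin d)) ℂ :=
  inclusion N d * ρ.matrix * (inclusion N d)ᴴ

theorem MixedState.trace_fock_mul (ρ : MixedState N d)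
    (X : Matrix (Finset (Fin d)) (Finset (Fin d)) ℂ) :
    (ρ.fock * X).trace = (ρ.matrix * X.submatrix Subtype.val Subtype.val).trace := by
  rw [fock, ← conjTranspose_inclusion_mul_mul, Matrix.mul_assoc, Matrix.mul_assoc,
    Matrix.trace_mul_comm]
  simp only [Matrix.mul_assoc]

theorem MixedState.posSemidef_fock (ρ : MixedState N d) : ρ.fock.PosSemidef :=
  ρ.posSemidef.mul_mul_conjTranspose_same _

theorem MixedState.trace_fock (ρ : MixedState N d) : ρ.fock.trace = 1 := by
  rw [← Matrix.mul_one ρ.fock, trace_fock_mul, Matrix.submatrix_one _ Subtype.val_injective,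
    Matrix.mul_one, ρ.trace_eq_one]

theorem oneRDM_apply (ρ : MixedState N d) (i j : Fin d) :
    oneRDM ρ i j = (ρ.fock * ((annihilation j)ᴴ * annihilation i)).trace := by
  rw [ρ.trace_fock_mul, conjTranspose_annihilation]
  rfl

theorem hopping_diag (j i : Fin d) (c : Config N d) :
    hopping N j i c c = if i = j ∧ i ∈ c.1 then 1 else 0 := by
  rw [hopping, ← Matrix.mul_one (annihilation i), Matrix.submatrix_apply, creation_mul_apply,
    annihilation_mul_apply, Matrix.one_apply]
  by_cases hj : j ∈ c.1
  · by_cases hij : i = j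
    · subst hij
      simp [hj, jwSign_erase, jwSign_mul_self]
    · have : insert i (c.1.erase j) ≠ c.1 := fun h => by
        have := h ▸ hj
        simp [Ne.symm hij] at this
      simp [hj, hij, this]
  · have : ¬ (i = j ∧ i ∈ c.1) := fun h => hj (h.1 ▸ h.2)
    simp [hj, this]

theorem hopping_self (i : Fin d) :
    hopping N i i = Matrix.diagonal fun c : Config N d => if i ∈ c.1 then (1 : ℂ) else 0 := by
  ext S T
  by_cases h : S = T
  · subst h
    simp [hopping_diag]
  · rw [Matrix.diagonal_apply_ne _ h, hopping, ← Matrix.mul_one (annihilation i),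
      Matrix.submatrix_apply, creation_mul_apply, annihilation_mul_apply]
    have h' : S.1 ≠ T.1 := fun h' => h (Subtype.ext h')
    by_cases hi : i ∈ S.1 <;> simp [hi, h']

/-- The total number operator is the scalar `N` on `Λᴺ ℂᵈ`. -/
theorem trace_oneRDM (ρ : MixedState N d) : (oneRDM ρ).trace = N := by
  have h : ∑ i : Fin d, hopping N i i = (N : ℂ) • (1 : Matrix (Config N d) (Config N d) ℂ) := by
    simp_rw [hopping_self]
    ext S T
    rw [Matrix.sum_apply]
    by_cases h : S = T
    · subst h
      simp [S.2]
    · simp [h]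
  simp only [Matrix.trace, oneRDM, Matrix.diag, Matrix.of_apply]
  change ∑ i, (ρ.matrix * hopping N i i).trace = _
  rw [← Matrix.trace_sum, ← Matrix.mul_sum, h, Matrix.mul_smul, Matrix.trace_smul, Matrix.mul_one,
    ρ.trace_eq_one, smul_eq_mul, mul_one]

/-- The annihilation operators of the natural orbitals. -/
noncomputable def naturalAnnihilation (ρ : MixedState N d) :
    Fin d → Matrix (Finset (Fin d)) (Finset (Fin d)) ℂ :=
  rotate (oneRDM_isHermitian ρ).eigenvectorUnitary annihilation

theorem conjTranspose_eigenvectorUnitary_mul (ρ : MixedState N d) :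
    ((oneRDM_isHermitian ρ).eigenvectorUnitary : Matrix (Fin d) (Fin d) ℂ)ᴴ *
      (oneRDM_isHermitian ρ).eigenvectorUnitary = 1 :=
  Unitary.coe_star_mul_self _

theorem eigenvectorUnitary_mul_conjTranspose (ρ : MixedState N d) :
    ((oneRDM_isHermitian ρ).eigenvectorUnitary : Matrix (Fin d) (Fin d) ℂ) *
      ((oneRDM_isHermitian ρ).eigenvectorUnitary : Matrix (Fin d) (Fin d) ℂ)ᴴ = 1 :=
  Unitary.coe_mul_star_self _

theorem car_naturalAnnihilation (ρ : MixedState N d) : CAR (naturalAnnihilation ρ) :=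
  car_annihilation.rotate (conjTranspose_eigenvectorUnitary_mul ρ)

/-- Passing to the natural orbitals conjugates the one-particle matrix by its eigenvector unitary;
this supplies the hypothesis `hlam` of `CAR.pair_le`. -/
theorem trace_fock_mul_naturalAnnihilation (ρ : MixedState N d) (j k : Fin d) :
    (ρ.fock * ((naturalAnnihilation ρ j)ᴴ * naturalAnnihilation ρ k)).trace
      = if j = k then ((oneRDM_isHermitian ρ).eigenvalues j : ℂ) else 0 := by
  set U : Matrix (Fin d) (Fin d) ℂ :=
    ((oneRDM_isHermitian ρ).eigenvectorUnitary : Matrix (Fin d) (Fin d) ℂ) with hU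
  have h1 : (ρ.fock * ((naturalAnnihilation ρ j)ᴴ * naturalAnnihilation ρ k)).trace
      = (Uᴴ * oneRDM ρ * U) k j := by
    rw [naturalAnnihilation, rotate_conjTranspose, Fermion.rotate, Finset.sum_mul_sum,
      Matrix.mul_sum, Matrix.trace_sum, Matrix.mul_apply]
    refine Finset.sum_congr rfl fun i _ => ?_
    rw [Matrix.mul_sum, Matrix.trace_sum, Matrix.mul_apply, Finset.sum_mul]
    refine Finset.sum_congr rfl fun l _ => ?_
    rw [oneRDM_apply, Matrix.smul_mul, Matrix.mul_smul, Matrix.mul_smul, Matrix.mul_smul,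
      Matrix.trace_smul, Matrix.trace_smul, Matrix.conjTranspose_apply, smul_eq_mul, smul_eq_mul]
    ring
  have h2 : Uᴴ * oneRDM ρ * U
      = Matrix.diagonal fun i => ((oneRDM_isHermitian ρ).eigenvalues i : ℂ) := by
    have h := (oneRDM_isHermitian ρ).conjStarAlgAut_star_eigenvectorUnitary
    rw [Unitary.conjStarAlgAut_star_apply] at h
    exact h
  rw [h1, h2, Matrix.diagonal_apply]
  by_cases h : j = k
  · simp [h]
  · simp [h, Ne.symm h]

end Embedding

/-! ### Bounds on natural occupation numbers -/

section Bounds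

variable {N d : ℕ}

/-- `eigenvalues` is labelled through a chosen equivalence and need not be decreasing along `Fin d`,
unlike `occ`; the permutation matches ordered occupation numbers with natural orbitals. -/
theorem exists_perm_occ (ρ : MixedState N d) :
    ∃ e : Equiv.Perm (Fin d), ∀ i, occ ρ i = (oneRDM_isHermitian ρ).eigenvalues (e i) :=
  ⟨(finCongr (Fintype.card_fin d).symm).trans (Fintype.equivOfCardEq (Fintype.card_fin _)),
    fun i => by simp [occ, Matrix.IsHermitian.eigenvalues]⟩

theorem occ_antitone (ρ : MixedState N d) : Antitone (occ ρ) := fun _ _ h =>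
  (oneRDM_isHermitian ρ).eigenvalues₀_antitone h

theorem occ_nonneg (ρ : MixedState N d) (i : Fin d) : 0 ≤ occ ρ i := by
  obtain ⟨e, he⟩ := exists_perm_occ ρ
  have h := re_trace_mul_nonneg ρ.posSemidef_fock (naturalAnnihilation ρ (e i))
  rwa [trace_fock_mul_naturalAnnihilation, if_pos rfl, Complex.ofReal_re, ← he] at h

theorem trace_fock_mul_hole (ρ : MixedState N d) (j k : Fin d) :
    (ρ.fock * (naturalAnnihilation ρ j * (naturalAnnihilation ρ k)ᴴ)).trace
      = if j = k then ((1 - (oneRDM_isHermitian ρ).eigenvalues j : ℝ) : ℂ) else 0 := by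
  rw [eq_sub_of_add_eq ((car_naturalAnnihilation ρ).anticomm_conj j k), Matrix.mul_sub,
    Matrix.trace_sub, trace_fock_mul_naturalAnnihilation]
  by_cases h : j = k
  · simp [h, ρ.trace_fock]
  · simp [h, Ne.symm h]

/-- The Pauli principle: the hole occupation `1 - λ` is the expectation of a positive operator. -/
theorem occ_le_one (ρ : MixedState N d) (i : Fin d) : occ ρ i ≤ 1 := by
  obtain ⟨e, he⟩ := exists_perm_occ ρ
  have h := re_trace_mul_nonneg ρ.posSemidef_fock (naturalAnnihilation ρ (e i))ᴴ
  rw [Matrix.conjTranspose_conjTranspose, trace_fock_mul_hole, if_pos rfl, Complex.ofReal_re,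
    ← he] at h
  linarith

theorem sum_occ (ρ : MixedState N d) : ∑ i, occ ρ i = N := by
  obtain ⟨e, he⟩ := exists_perm_occ ρ
  simp_rw [he]
  rw [Equiv.sum_comp e]
  have h := (oneRDM_isHermitian ρ).trace_eq_sum_eigenvalues
  rw [trace_oneRDM] at h
  apply Complex.ofReal_injective
  rw [Complex.ofReal_sum, Complex.ofReal_natCast]
  exact h.symm

/-- An eigenvalue of a state comes with a pure state, dominated by it with that weight. -/
theorem exists_pure_le (ρ : MixedState N d) {c : ℝ} (hc : c ∈ spectrum ℝ ρ.matrix) :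
    0 ≤ c ∧ ∃ ψ, HasParticles N ψ ∧ sqNorm ψ = 1 ∧
      (ρ.fock - (c : ℂ) • Matrix.vecMulVec ψ (star ψ)).PosSemidef := by
  have hA := ρ.posSemidef
  rw [hA.isHermitian.spectrum_real_eq_range_eigenvalues] at hc
  obtain ⟨i, rfl⟩ := hc
  refine ⟨hA.eigenvalues_nonneg i, inclusion N d *ᵥ ⇑(hA.isHermitian.eigenvectorBasis i),
    hasParticles_inclusion _, ?_, ?_⟩
  · rw [sqNorm_mulVec_of_isometry conjTranspose_inclusion_mul]
    have h := hA.isHermitian.eigenvectorBasis.orthonormal.1 i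
    rw [EuclideanSpace.norm_eq, Real.sqrt_eq_one] at h
    simpa only [sqNorm, Complex.normSq_eq_norm_sq] using h
  · have h := (posSemidef_sub_eigenvector hA i).mul_mul_conjTranspose_same (inclusion N d)
    rwa [Matrix.mul_sub, Matrix.sub_mul, Matrix.mul_smul, Matrix.smul_mul, Matrix.mul_vecMulVec,
      Matrix.vecMulVec_mul, ← Matrix.star_mulVec] at h

/-- Removing two of three particles leaves one, so `CAR.pair_le` applies with `ω` the vacuum `∅`. -/
theorem occ_add_occ_sub_le (ρ : MixedState 3 d) {c : ℝ} (hc : c ∈ spectrum ℝ ρ.matrix)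
    {p q : Fin d} (hpq : p ≠ q) {μ : ℝ} (hμ0 : 0 ≤ μ)
    (hμ : ∀ k, k ≠ p → k ≠ q → occ ρ k ≤ μ) : occ ρ p + occ ρ q - μ ≤ 2 - c := by
  obtain ⟨hc0, ψ, hψN, hψ, hP⟩ := exists_pure_le ρ hc
  obtain ⟨e, he⟩ := exists_perm_occ ρ
  rw [he, he]
  refine (car_naturalAnnihilation ρ).pair_le ρ.trace_fock hψ hc0 hP
    (trace_fock_mul_naturalAnnihilation ρ) (e.injective.ne hpq) ∅ ?_ hμ0 fun k hkp hkq => ?_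
  · rw [naturalAnnihilation, sqNorm_rotate_apply (eigenvectorUnitary_mul_conjTranspose ρ)]
    exact HasParticles.sqNorm_one
      (.rotate (fun i => .annihilation (.rotate (fun j => .annihilation hψN j) _) i) _)
  · have h := hμ (e.symm k) (fun h => hkp (by rw [← h, e.apply_symm_apply]))
      (fun h => hkq (by rw [← h, e.apply_symm_apply]))
    rwa [he, e.apply_symm_apply] at h

/-- The particle-hole dual: `N` particles in `N + 3` modes are three holes, and adding two particles
leaves one hole below the filled state `Finset.univ`. -/
theorem sub_occ_sub_occ_le (ρ : MixedState N (N + 3)) {c : ℝ} (hc : c ∈ spectrum ℝ ρ.matrix)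
    {p q : Fin (N + 3)} (hpq : p ≠ q) {μ : ℝ} (hμ0 : μ ≤ 1)
    (hμ : ∀ k, k ≠ p → k ≠ q → μ ≤ occ ρ k) : μ - occ ρ p - occ ρ q ≤ 1 - c := by
  obtain ⟨hc0, ψ, hψN, hψ, hP⟩ := exists_pure_le ρ hc
  obtain ⟨e, he⟩ := exists_perm_occ ρ
  have key : (1 - occ ρ p) + (1 - occ ρ q) - (1 - μ) ≤ 2 - c := by
    rw [he, he]
    refine (car_naturalAnnihilation ρ).dual.pair_le
      (lam := fun k => 1 - (oneRDM_isHermitian ρ).eigenvalues k) ρ.trace_fock hψ hc0 hP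
      (fun j k => ?_) (e.injective.ne hpq) Finset.univ ?_ (sub_nonneg.mpr hμ0) fun k hkp hkq => ?_
    · rw [Matrix.conjTranspose_conjTranspose, trace_fock_mul_hole]
    · simp only [naturalAnnihilation, conjTranspose_rotate, conjTranspose_annihilation]
      rw [sqNorm_rotate_apply]
      · exact HasParticles.sqNorm_pred
          (.rotate (fun i => .creation (.rotate (fun j => .creation hψN j) _) i) _)
      -- Creation operators rotate by the entrywise conjugate of the unitary, which is again
      -- unitary.
      · have h := congrArg (fun M => M.map star) (eigenvectorUnitary_mul_conjTranspose ρ)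
        ext i j
        have h' := congrFun (congrFun h i) j
        simp only [Matrix.map_apply, Matrix.mul_apply, star_sum, star_mul', Matrix.one_apply,
          Matrix.conjTranspose_apply] at h' ⊢
        rw [h']
        split_ifs <;> simp
    · have h := hμ (e.symm k) (fun h => hkp (by rw [← h, e.apply_symm_apply]))
        (fun h => hkq (by rw [← h, e.apply_symm_apply]))
      rw [he, e.apply_symm_apply] at h
      linarith
  linarith

end Bounds

/-! ### Mixtures of configurations -/

section Mixture

variable {N d : ℕ}

/-- A decreasing family of diagonal entries of a diagonal one-particle reduced density matrix is the
family of natural occupation numbers. -/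
theorem occ_eq_of_diagonal (ρ : MixedState N d) {f : Fin d → ℝ} (hf : Antitone f)
    (h : oneRDM ρ = Matrix.diagonal fun i => (f i : ℂ)) : occ ρ = f := by
  obtain ⟨e, he⟩ := exists_perm_occ ρ
  have h1 := (oneRDM_isHermitian ρ).roots_charpoly_eq_eigenvalues
  have h2 : (oneRDM ρ).charpoly.roots = Multiset.map (fun i => (f i : ℂ)) Finset.univ.val := by
    rw [h, Matrix.charpoly_diagonal, Polynomial.roots_prod]
    · simp
    · simp [Finset.prod_ne_zero_iff, Polynomial.X_sub_C_ne_zero]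
  -- The roots of the characteristic polynomial identify the two families as multisets; two sorted
  -- lists with the same multiset coincide.
  have h3 : Multiset.map (occ ρ) Finset.univ.val = Multiset.map f Finset.univ.val := by
    have h4 : Multiset.map (occ ρ) Finset.univ.val
        = Multiset.map (oneRDM_isHermitian ρ).eigenvalues Finset.univ.val := by
      conv_rhs => rw [← Finset.map_univ_equiv e, Finset.map_val, Multiset.map_map]
      exact Multiset.map_congr rfl fun i _ => he i
    have h5 := congrArg (Multiset.map Complex.re) (h1.symm.trans h2)
    rw [Multiset.map_map, Multiset.map_map] at h5
    rw [h4]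
    exact h5
  rw [Fin.univ_val_map, Fin.univ_val_map, Multiset.coe_eq_coe] at h3
  exact List.ofFn_injective (h3.eq_of_sortedGE (occ_antitone ρ).sortedGE_ofFn hf.sortedGE_ofFn)

variable {ι : Type*} [Fintype ι]

/-- The probability of the configuration `S` in a statistical mixture of configurations. -/
noncomputable def mixtureProb (w : ι → ℝ) (c : ι → Config N d) (S : Config N d) : ℝ :=
  ∑ k, if c k = S then w k else 0

/-- A statistical mixture of configurations. -/
noncomputable def mixture (w : ι → ℝ) (c : ι → Config N d) (hw : ∀ k, 0 ≤ w k)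
    (hsum : ∑ k, w k = 1) : MixedState N d where
  matrix := Matrix.diagonal fun S => (mixtureProb w c S : ℂ)
  posSemidef := .diagonal fun S => Complex.zero_le_real.mpr <| Finset.sum_nonneg fun k _ => by
    split_ifs
    · exact hw k
    · exact le_rfl
  trace_eq_one := by
    rw [Matrix.trace_diagonal, ← Complex.ofReal_sum]
    simp only [mixtureProb]
    rw [Finset.sum_comm]
    simp [hsum]

theorem oneRDM_mixture {w : ι → ℝ} {c : ι → Config N d} (hw : ∀ k, 0 ≤ w k)
    (hsum : ∑ k, w k = 1) : oneRDM (mixture w c hw hsum)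
      = Matrix.diagonal fun i => ((∑ k, if i ∈ (c k).1 then w k else 0 : ℝ) : ℂ) := by
  ext i j
  have h : oneRDM (mixture w c hw hsum) i j
      = ∑ S, (mixtureProb w c S : ℂ) * if i = j ∧ i ∈ S.1 then 1 else 0 := by
    simp [oneRDM, mixture, Matrix.trace, hopping_diag]
  rw [h]
  by_cases hij : i = j
  · subst hij
    simp only [true_and, mixtureProb, Matrix.diagonal_apply_eq, Complex.ofReal_sum, Finset.sum_mul]
    rw [Finset.sum_comm]
    refine Finset.sum_congr rfl fun k _ => ?_
    rw [Finset.sum_eq_single (c k)]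
    · by_cases hi : i ∈ (c k).1 <;> simp [hi]
    · intro S _ hS
      simp [hS.symm]
    · simp
  · simp [hij]

/-- Injectivity of `c` keeps the weights from merging; the eigenvalues are then the weights,
together with `0` if some configuration is absent. -/
theorem isGreatest_spectrum_mixture {w : ι → ℝ} {c : ι → Config N d} (hw : ∀ k, 0 ≤ w k)
    (hsum : ∑ k, w k = 1) (hc : Function.Injective c) {k : ι} (hk : ∀ l, w l ≤ w k) :
    IsGreatest (spectrum ℝ (mixture w c hw hsum).matrix) (w k) := by
  have h : spectrum ℝ (mixture w c hw hsum).matrix = Set.range (mixtureProb w c) := by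
    ext x
    rw [← spectrum.algebraMap_mem_iff ℂ, mixture, spectrum_diagonal]
    simp
  have hp : ∀ l, mixtureProb w c (c l) = w l := fun l => by
    classical
    simp [mixtureProb, hc.eq_iff]
  rw [h]
  refine ⟨⟨c k, hp k⟩, ?_⟩
  rintro _ ⟨S, rfl⟩
  by_cases hS : ∃ l, c l = S
  · obtain ⟨l, rfl⟩ := hS
    rw [hp]
    exact hk l
  · have : mixtureProb w c S = 0 := Finset.sum_eq_zero fun l _ => if_neg fun h => hS ⟨l, h⟩
    rw [this]
    exact hw k

theorem ketbra_eq_diagonal (S : Config N d) : ketbra S = Matrix.diagonal (Pi.single S 1) := by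
  ext T R
  by_cases hT : T = S
  · subst hT
    by_cases hR : T = R
    · subst hR
      simp [ketbra, Matrix.vecMulVec_apply]
    · simp [ketbra, Matrix.vecMulVec_apply, hR, Ne.symm hR]
  · by_cases hR : T = R
    · subst hR
      simp [ketbra, Matrix.vecMulVec_apply, hT]
    · simp [ketbra, Matrix.vecMulVec_apply, hT, hR]

theorem mixture_matrix {w : ι → ℝ} {c : ι → Config N d} (hw : ∀ k, 0 ≤ w k)
    (hsum : ∑ k, w k = 1) :
    (mixture w c hw hsum).matrix = ∑ k, (w k : ℂ) • ketbra (c k) := by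
  ext S T
  simp_rw [ketbra_eq_diagonal, Matrix.sum_apply, Matrix.smul_apply, mixture]
  by_cases h : S = T
  · subst h
    simp [mixtureProb, Pi.single_apply, eq_comm, apply_ite]
  · simp [h]

end Mixture

/-! ### Three fermions in six modes: the inequalities and the examples -/

theorem occ_bounds (ρ : MixedState 3 6) {ε : ℝ} (h : 1 - ε ∈ spectrum ℝ ρ.matrix) :
    occ ρ 0 + occ ρ 1 - occ ρ 2 ≤ 1 + ε ∧ occ ρ 0 + occ ρ 1 + occ ρ 3 ≤ 2 + ε := by
  have h1 : occ ρ 0 + occ ρ 1 - occ ρ 2 ≤ 2 - (1 - ε) :=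
    occ_add_occ_sub_le ρ h (by decide) (occ_nonneg ρ 2) fun k h0 h1 =>
      occ_antitone ρ (by revert k; decide)
  have h2 : occ ρ 3 - occ ρ 4 - occ ρ 5 ≤ 1 - (1 - ε) :=
    sub_occ_sub_occ_le (N := 3) ρ h (by decide) (occ_le_one ρ 3) fun k h0 h1 =>
      occ_antitone ρ (by revert k; decide)
  have h3 := sum_occ ρ
  rw [Fin.sum_univ_six] at h3
  push_cast at h3
  -- For the second inequality, adding `h1`, `h2` and `h3` gives `2 (λ₁ + λ₂ + λ₄) ≤ 4 + 2ε`.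
  constructor <;> linarith

theorem occ_mixture {ι : Type*} [Fintype ι] {w : ι → ℝ} {c : ι → Config 3 6} (hw : ∀ k, 0 ≤ w k)
    (hsum : ∑ k, w k = 1) {f : Fin 6 → ℝ} (hf : ∀ i : Fin 5, f i.succ ≤ f i.castSucc)
    (h : ∀ i, ∑ k, (if i ∈ (c k).1 then w k else 0) = f i) : occ (mixture w c hw hsum) = f := by
  refine occ_eq_of_diagonal _ (Fin.antitone_iff_succ_le.mpr hf) ?_
  rw [oneRDM_mixture]
  simp_rw [h]

theorem exists_saturating {ε : ℝ} (h0 : 0 ≤ ε) (h1 : ε ≤ 1 / 2) : ∃ ρ : MixedState 3 6,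
    ρ.matrix = ((1 - ε : ℝ) : ℂ) • ketbra (N := 3) (d := 6) ⟨{0, 1, 2}, rfl⟩ +
      (ε : ℂ) • ketbra (N := 3) (d := 6) ⟨{0, 1, 3}, rfl⟩ ∧
    IsGreatest (spectrum ℝ ρ.matrix) (1 - ε) ∧ occ ρ = ![1, 1, 1 - ε, ε, 0, 0] := by
  let c : Fin 2 → Config 3 6 := ![⟨{0, 1, 2}, rfl⟩, ⟨{0, 1, 3}, rfl⟩]
  have hc : Function.Injective c := by decide
  have hw : ∀ k, 0 ≤ ![1 - ε, ε] k := by simp [Fin.forall_fin_succ]; constructor <;> linarith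
  have hsum : ∑ k, ![1 - ε, ε] k = 1 := by simp
  refine ⟨mixture _ c hw hsum, ?_, ?_, ?_⟩
  · rw [mixture_matrix, Fin.sum_univ_two]
    rfl
  · refine isGreatest_spectrum_mixture (k := 0) hw hsum hc ?_
    simp [Fin.forall_fin_succ]
    linarith
  · refine occ_mixture hw hsum ?_ ?_
    · simp [Fin.forall_fin_succ]
      refine ⟨?_, ?_, ?_⟩ <;> linarith
    · simp [Fin.forall_fin_succ, c]

/-- Spreading the weight `ε` evenly over the three upper modes makes the pair sums `1 + ε/3`, `1 +
ε/3` and `1 - 2ε/3`. -/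
theorem exists_unpaired {ε : ℝ} (h0 : 0 < ε) (h1 : ε ≤ 1 / 2) : ∃ ρ : MixedState 3 6,
    IsGreatest (spectrum ℝ ρ.matrix) (1 - ε) ∧
    occ ρ = ![1, 1, 1 - ε, ε / 3, ε / 3, ε / 3] := by
  let c : Fin 4 → Config 3 6 :=
    ![⟨{0, 1, 2}, rfl⟩, ⟨{0, 1, 3}, rfl⟩, ⟨{0, 1, 4}, rfl⟩, ⟨{0, 1, 5}, rfl⟩]
  have hc : Function.Injective c := by decide
  have hw : ∀ k, 0 ≤ ![1 - ε, ε / 3, ε / 3, ε / 3] k := by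
    simp [Fin.forall_fin_succ]; constructor <;> linarith
  have hsum : ∑ k, ![1 - ε, ε / 3, ε / 3, ε / 3] k = 1 := by simp [Fin.sum_univ_succ]; ring
  refine ⟨mixture _ c hw hsum, ?_, ?_⟩
  · refine isGreatest_spectrum_mixture (k := 0) hw hsum hc ?_
    simp [Fin.forall_fin_succ]
    linarith
  · refine occ_mixture hw hsum ?_ ?_
    · simp [Fin.forall_fin_succ]
      constructor <;> linarith
    · simp [Fin.forall_fin_succ, c, Fin.sum_univ_succ]
      ring

/-- The numbers are chosen to saturate the first inequality; the left side of the second is then `(7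
+ ε)/3`, which exceeds `2 + ε` exactly when `ε < 1/2`. -/
theorem exists_occ_of_lt_half {ε : ℝ} (h0 : 0 ≤ ε) (h1 : ε < 1 / 2) : ∃ ρ : MixedState 3 6,
    occ ρ = ![1, (2 + 2 * ε) / 3, (2 - ε) / 3, (2 - ε) / 3, 0, 0] := by
  let c : Fin 3 → Config 3 6 := ![⟨{0, 1, 2}, rfl⟩, ⟨{0, 1, 3}, rfl⟩, ⟨{0, 2, 3}, rfl⟩]
  have hw : ∀ k, 0 ≤ ![(1 + ε) / 3, (1 + ε) / 3, (1 - 2 * ε) / 3] k := by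
    simp [Fin.forall_fin_succ]; constructor <;> linarith
  have hsum : ∑ k, ![(1 + ε) / 3, (1 + ε) / 3, (1 - 2 * ε) / 3] k = 1 := by
    simp [Fin.sum_univ_succ]; ring
  refine ⟨mixture _ c hw hsum, occ_mixture hw hsum ?_ ?_⟩
  · simp [Fin.forall_fin_succ]
    refine ⟨?_, ?_, ?_⟩ <;> linarith
  · simp [Fin.forall_fin_succ, c, Fin.sum_univ_succ]
    refine ⟨?_, ?_, ?_⟩ <;> ring

/-- The bound `2/5 ≤ t` is what makes `t ≥ (2 - t)/4`, so that the list is decreasing. -/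
theorem exists_occ_of_le_one {t : ℝ} (h0 : 2 / 5 ≤ t) (h1 : t ≤ 1) : ∃ ρ : MixedState 3 6,
    occ ρ = ![1, t, (2 - t) / 4, (2 - t) / 4, (2 - t) / 4, (2 - t) / 4] := by
  let c : Fin 6 → Config 3 6 := ![⟨{0, 1, 2}, rfl⟩, ⟨{0, 1, 3}, rfl⟩, ⟨{0, 1, 4}, rfl⟩,
    ⟨{0, 1, 5}, rfl⟩, ⟨{0, 2, 3}, rfl⟩, ⟨{0, 4, 5}, rfl⟩]
  have hw : ∀ k, 0 ≤ ![t / 4, t / 4, t / 4, t / 4, (1 - t) / 2, (1 - t) / 2] k := by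
    simp [Fin.forall_fin_succ]; constructor <;> linarith
  have hsum : ∑ k, ![t / 4, t / 4, t / 4, t / 4, (1 - t) / 2, (1 - t) / 2] k = 1 := by
    simp [Fin.sum_univ_succ]; ring
  refine ⟨mixture _ c hw hsum, occ_mixture hw hsum ?_ ?_⟩
  · simp [Fin.forall_fin_succ]
    refine ⟨?_, ?_⟩ <;> linarith
  · simp [Fin.forall_fin_succ, c, Fin.sum_univ_succ]
    refine ⟨?_, ?_, ?_⟩ <;> ring

end Fermion

theorem proposition2 :
    -- a state whose largest eigenvalue is `1 - ε`
    (∀ (ρ : Fermion.MixedState 3 6) (ε : ℝ), IsGreatest (spectrum ℝ ρ.matrix) (1 - ε) →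
      Antitone (Fermion.occ ρ) ∧
      (∀ i : Fin 6, 0 ≤ Fermion.occ ρ i ∧ Fermion.occ ρ i ≤ 1) ∧
      ∑ i : Fin 6, Fermion.occ ρ i = 3 ∧
      Fermion.occ ρ 0 + Fermion.occ ρ 1 - Fermion.occ ρ 2 ≤ 1 + ε ∧
      Fermion.occ ρ 0 + Fermion.occ ρ 1 + Fermion.occ ρ 3 ≤ 2 + ε) ∧
    -- the state `(1 - ε)|111000⟩⟨111000| + ε|110100⟩⟨110100|` saturates both inequalities
    (∀ ε : ℝ, 0 ≤ ε → ε ≤ 1 / 2 → ∃ ρ : Fermion.MixedState 3 6,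
      ρ.matrix = ((1 - ε : ℝ) : ℂ) • Fermion.ketbra (N := 3) (d := 6) ⟨{0, 1, 2}, rfl⟩ +
        (ε : ℂ) • Fermion.ketbra (N := 3) (d := 6) ⟨{0, 1, 3}, rfl⟩ ∧
      IsGreatest (spectrum ℝ ρ.matrix) (1 - ε) ∧
      Fermion.occ ρ = ![1, 1, 1 - ε, ε, 0, 0] ∧
      Fermion.occ ρ 0 + Fermion.occ ρ 1 - Fermion.occ ρ 2 = 1 + ε ∧
      Fermion.occ ρ 0 + Fermion.occ ρ 1 + Fermion.occ ρ 3 = 2 + ε) ∧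
    -- the equalities that hold for pure states can all fail
    (∀ ε : ℝ, 0 < ε → ε ≤ 1 / 2 → ∃ ρ : Fermion.MixedState 3 6,
      IsGreatest (spectrum ℝ ρ.matrix) (1 - ε) ∧
      Fermion.occ ρ 0 + Fermion.occ ρ 5 ≠ 1 ∧
      Fermion.occ ρ 1 + Fermion.occ ρ 4 ≠ 1 ∧
      Fermion.occ ρ 2 + Fermion.occ ρ 3 ≠ 1) ∧
    -- among mixed states, neither of the two inequalities implies the other
    (∀ ε : ℝ, 0 ≤ ε → ε < 1 / 2 →
      (∃ ρ : Fermion.MixedState 3 6,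
        Fermion.occ ρ 0 + Fermion.occ ρ 1 - Fermion.occ ρ 2 ≤ 1 + ε ∧
        ¬ Fermion.occ ρ 0 + Fermion.occ ρ 1 + Fermion.occ ρ 3 ≤ 2 + ε) ∧
      (∃ ρ : Fermion.MixedState 3 6,
        ¬ Fermion.occ ρ 0 + Fermion.occ ρ 1 - Fermion.occ ρ 2 ≤ 1 + ε ∧
        Fermion.occ ρ 0 + Fermion.occ ρ 1 + Fermion.occ ρ 3 ≤ 2 + ε)) := by
  refine ⟨fun ρ ε h => ⟨Fermion.occ_antitone ρ,
    fun i => ⟨Fermion.occ_nonneg ρ i, Fermion.occ_le_one ρ i⟩,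
    by simpa using Fermion.sum_occ ρ, Fermion.occ_bounds ρ h.1⟩,
    fun ε h0 h1 => ?_, fun ε h0 h1 => ?_, fun ε h0 h1 => ⟨?_, ?_⟩⟩
  · obtain ⟨ρ, hρ, hs, ho⟩ := Fermion.exists_saturating h0 h1
    refine ⟨ρ, hρ, hs, ho, ?_, ?_⟩ <;> simp [ho]
    ring
  · obtain ⟨ρ, hs, ho⟩ := Fermion.exists_unpaired h0 h1
    refine ⟨ρ, hs, ?_, ?_, ?_⟩ <;> rw [ho] <;> simp <;> intro h <;> linarith
  · obtain ⟨ρ, ho⟩ := Fermion.exists_occ_of_lt_half h0 h1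
    refine ⟨ρ, ?_, ?_⟩ <;> rw [ho] <;> simp <;> linarith
  -- With this `t` the left sides are `9/8 + 5ε/4 > 1 + ε` and `15/8 + 3ε/4 ≤ 2 + ε`.
  · obtain ⟨ρ, ho⟩ := Fermion.exists_occ_of_le_one (t := 1 / 2 + ε) (by linarith) (by linarith)
    refine ⟨ρ, ?_, ?_⟩ <;> rw [ho] <;> simp <;> linarith
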